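/- Let $G=\langle a_1,\dots,a_k\mid R_1,\dots,R_\ell\rangle$ be a finitely presented group, $k\ge 1$, whose relators $R_i$ are freely reduced and non-empty. Let $\mathcal S=\{a_1^{\pm1},\dots,a_k^{\pm1}\}$ ($2k$ formal letters), let $\mathcal X$ be the set of freely reduced words over $\mathcal S$ that represent the identity of $G$, and let $\mathcal R$ be the set of free reductions of all cyclic permutations of the words $R_i$ and $R_i^{-1}$. Write $|w|$ for the length of a word $w$. Let $p_c\in(0,1)$, $\alpha\in\mathbb R$, $\beta\in(0,1)$, and let $P$ be a probability distribution on $\mathcal R$ with $P(R)>0$ and $P(R)=P(R^{-1})$ for all $R\in\mathcal R$. Elementary moves on $w\in\mathcal X$: - Conjugation by $x\in\mathcal S$: the result $w''$ is the free reduction of $xwx^{-1}$. - Left-insertion of $R\in\mathcal R$ at position $m\in\{0,\dots,|w|\}$: write $w=uv$ with $|v|=m$ and let $u'$ be the free reduction of $uR$. If $u'v$ is freely reduced then $w''=u'v$; otherwise (a letter of $v$ would be cancelled) $w''=w$. Consider the Markov chain on $\mathcal X$ that moves from $w$ as follows. With probability $p_c$, choose $x\in\mathcal S$ uniformly, let $w''$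 be the result of conjugation by $x$, and move to $w''$ with probability $$\min\Bigl\{1,\ \frac{(|w''|+1)^{1+\alpha}}{(|w|+1)^{1+\alpha}}\cdot\frac{\beta^{|w''|}}{\beta^{|w|}}\Bigr\},$$ staying at $w$ otherwise. With probability $1-p_c$, choose $R\in\mathcal R$ with law $P$ and $m\in\{0,\dots,|w|\}$ uniformly, let $w''$ be the result of left-insertion of $R$ at $m$, and move to $w''$ with probability $$\min\Bigl\{1,\ \frac{(|w''|+1)^{\alpha}}{(|w|+1)^{\alpha}}\cdot\frac{\beta^{|w''|}}{\beta^{|w|}}\Bigr\},$$ staying at $w$ otherwise. Let $\Pr(u\to v)$ and $\Pr_n(u\to v)$ be its one-step and $n$-step transition probabilities. A probability distribution $\varphi$ on $\mathcal X$ is stationary if $\varphi(u)=\sum_{v}\Pr(v\to u)\varphi(v)$ for all $u\in\mathcal X$. Put $$Z=\sum_{w\in\mathcal X}(|w|+1)^{1+\alpha}\beta^{|w|}.$$ 1. If $\beta$ is less than the radius of convergence of the cogrowth series $\sum_n c(n)z^n$, where $c(n)$ is the number of words of length $n$ in $\mathcal X$, then $Z<\infty$. 2. Whenever $Z<\infty$,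 the formula $$\pi(v)=\frac{(|v|+1)^{1+\alpha}\beta^{|v|}}{Z}$$ defines a probability distribution on $\mathcal X$, it is the unique stationary distribution of the chain, and for all $u,v\in\mathcal X$ $$\Pr\nolimits_n(u\to v)\to\pi(v)\quad\text{as } n\to\infty.$$ -/

import Mathlib

open Filter Topology
open scoped ENNReal

namespace TrivialWords

/-- Words over the `2k` letters `a, a⁻¹` (`a` a generator): the letter `(a, true)` is `a` and
`(a, false)` is its formal inverse. -/
abbrev Word (A : Type*) := List (A × Bool)

/-- The formal inverse of a letter. -/
def letterInv {A : Type*} (x : A × Bool) : A × Bool := (x.1, !x.2)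

variable {A : Type*} [DecidableEq A]

/-- The state space: freely reduced words which represent the identity in `⟨A ∣ rels⟩`. -/
def State (rels : Set (FreeGroup A)) : Type _ :=
  {w : Word A // FreeGroup.IsReduced w ∧ PresentedGroup.mk rels (FreeGroup.mk w) = 1}

/-- The length of the word underlying a state. -/
def State.length {rels : Set (FreeGroup A)} (w : State rels) : ℕ := w.1.length

/-- The set `𝓡`: the free reductions of all cyclic permutations of the relators and of
their inverses. -/
def relatorSet (rels : Set (FreeGroup A)) : Set (Word A) :=
  {r | ∃ R ∈ rels, ∃ c : Word A,
    (c.IsRotated R.toWord ∨ c.IsRotated (FreeGroup.invRev R.toWord)) ∧ r = FreeGroup.reduce c}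

theorem isReduced_reduce (w : Word A) : FreeGroup.IsReduced (FreeGroup.reduce w) :=
  FreeGroup.IsReduced.of_reduce_eq FreeGroup.reduce.idem

theorem mk_reduce (w : Word A) : FreeGroup.mk (FreeGroup.reduce w) = FreeGroup.mk w :=
  FreeGroup.reduce.self

theorem mk_isRotated_trivial {rels : Set (FreeGroup A)} {c d : Word A} (h : c.IsRotated d)
    (hd : PresentedGroup.mk rels (FreeGroup.mk d) = 1) :
    PresentedGroup.mk rels (FreeGroup.mk c) = 1 := by
  obtain ⟨n, hn, rfl⟩ := List.isRotated_iff_mod.1 h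
  rw [List.rotate_eq_drop_append_take hn, ← FreeGroup.mul_mk, map_mul] at hd
  rw [← List.take_append_drop n c, ← FreeGroup.mul_mk, map_mul]
  exact mul_eq_one_comm.1 hd

theorem relatorSet_trivial {rels : Set (FreeGroup A)} {r : Word A} (hr : r ∈ relatorSet rels) :
    PresentedGroup.mk rels (FreeGroup.mk r) = 1 := by
  obtain ⟨R, hR, c, hc, rfl⟩ := hr
  rw [mk_reduce]
  rcases hc with hc | hc
  · refine mk_isRotated_trivial hc ?_
    rw [FreeGroup.mk_toWord]
    exact PresentedGroup.one_of_mem hR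
  · refine mk_isRotated_trivial hc ?_
    rw [← FreeGroup.inv_mk, FreeGroup.mk_toWord, map_inv, PresentedGroup.one_of_mem hR, inv_one]

theorem invRev_mem_relatorSet {rels : Set (FreeGroup A)} {r : Word A}
    (hr : r ∈ relatorSet rels) : FreeGroup.invRev r ∈ relatorSet rels := by
  obtain ⟨R, hR, c, hc, rfl⟩ := hr
  refine ⟨R, hR, FreeGroup.invRev c, ?_, (FreeGroup.reduce_invRev).symm⟩
  have key : ∀ {s t : Word A}, s.IsRotated t →
      (FreeGroup.invRev s).IsRotated (FreeGroup.invRev t) := by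
    intro s t h
    exact (h.map _).reverse
  rcases hc with hc | hc
  · exact Or.inr (key hc)
  · left
    simpa only [FreeGroup.invRev_invRev] using key hc

/-- The inverse `R⁻¹` of an element `R` of `𝓡`. -/
def relatorInv {rels : Set (FreeGroup A)} (R : relatorSet rels) : relatorSet rels :=
  ⟨FreeGroup.invRev R.1, invRev_mem_relatorSet R.2⟩

/-- Conjugation by the letter `x`: the free reduction of `x w x⁻¹`. -/
def conjMove {rels : Set (FreeGroup A)} (w : State rels) (x : A × Bool) : State rels :=
  ⟨FreeGroup.reduce (x :: w.1 ++ [letterInv x]), isReduced_reduce _, by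
    have h : FreeGroup.mk (x :: w.1 ++ [letterInv x])
        = FreeGroup.mk [x] * FreeGroup.mk w.1 * (FreeGroup.mk [x])⁻¹ := by
      simp [letterInv, FreeGroup.invRev]
    rw [mk_reduce, h, map_mul, map_mul, w.2.2, mul_one, map_inv, mul_inv_cancel]⟩

/-- Left-insertion of `R` at position `m`. Write `w = u v` with `|v| = m` and let `u'` be the free
reduction of `u R`. If `u' v` is freely reduced, the result is `u' v`; otherwise a letter of `v`
would be cancelled and the result is `w`. -/
def leftInsert {rels : Set (FreeGroup A)} (w : State rels) (R : relatorSet rels)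
    (m : Fin (w.length + 1)) : State rels :=
  let u := w.1.take (w.length - m)
  let v := w.1.drop (w.length - m)
  let u' := FreeGroup.reduce (u ++ R.1)
  if h : FreeGroup.reduce (u' ++ v) = u' ++ v then
    ⟨u' ++ v, FreeGroup.IsReduced.of_reduce_eq h, by
      have hw : PresentedGroup.mk rels (FreeGroup.mk (u ++ v)) = 1 := by
        rw [List.take_append_drop]; exact w.2.2
      rw [← FreeGroup.mul_mk, map_mul] at hw
      rw [← FreeGroup.mul_mk, map_mul, mk_reduce, ← FreeGroup.mul_mk, map_mul,
        relatorSet_trivial R.2, mul_one, hw]⟩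
  else w

/-- The Metropolis acceptance probability
`min {1, ((|w''| + 1)^e / (|w| + 1)^e) * (β^|w''| / β^|w|)}` for replacing `w` by `w''`. -/
noncomputable def acceptProb {rels : Set (FreeGroup A)} (e β : ℝ) (w w'' : State rels) : ℝ :=
  min 1 (((w''.length + 1 : ℝ) ^ e / (w.length + 1 : ℝ) ^ e) *
    (β ^ w''.length / β ^ w.length))

theorem acceptProb_mem {rels : Set (FreeGroup A)} (e : ℝ) {β : ℝ} (hβ : β ∈ Set.Ioo (0 : ℝ) 1)
    (w w'' : State rels) : acceptProb e β w w'' ∈ Set.Icc (0 : ℝ) 1 := by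
  have := hβ.1
  exact ⟨le_min zero_le_one (by positivity), min_le_left _ _⟩

/-- With probability `p` sample from `μ`, otherwise (with probability `1 - p`) from `ν`. -/
noncomputable def mix {X : Type*} (p : ℝ) (hp : p ∈ Set.Icc (0 : ℝ) 1) (μ ν : PMF X) : PMF X :=
  ⟨fun x => ENNReal.ofReal p * μ x + ENNReal.ofReal (1 - p) * ν x, by
    refine ENNReal.summable.hasSum_iff.2 ?_
    rw [ENNReal.tsum_add, ENNReal.tsum_mul_left, ENNReal.tsum_mul_left, μ.tsum_coe, ν.tsum_coe,
      mul_one, mul_one, ← ENNReal.ofReal_add hp.1 (by linarith [hp.2])]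
    simp⟩

/-- The proposal `w''` is accepted with probability `acceptProb e β w w''`; otherwise the chain
stays at `w`. -/
noncomputable def acceptReject {rels : Set (FreeGroup A)} (e β : ℝ) (hβ : β ∈ Set.Ioo (0 : ℝ) 1)
    (w w'' : State rels) : PMF (State rels) :=
  mix (acceptProb e β w w'') (acceptProb_mem e hβ w w'') (PMF.pure w'') (PMF.pure w)

/-- One step of the chain from the state `w`. With probability `pc` a letter is chosen uniformly
and conjugation by it is proposed (exponent `1 + α`); otherwise `R ∈ 𝓡` is chosen with law `P`, a
position in `{0, …, |w|}` is chosen uniformly, and the left-insertion is proposed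
(exponent `α`). -/
noncomputable def step {rels : Set (FreeGroup A)} [Fintype A] [Nonempty A]
    (pc : ℝ) (hpc : pc ∈ Set.Ioo (0 : ℝ) 1) (α β : ℝ) (hβ : β ∈ Set.Ioo (0 : ℝ) 1)
    (P : PMF (relatorSet rels)) (w : State rels) : PMF (State rels) :=
  mix pc (Set.Ioo_subset_Icc_self hpc)
    ((PMF.uniformOfFintype (A × Bool)).bind fun x =>
      acceptReject (1 + α) β hβ w (conjMove w x))
    (P.bind fun R => (PMF.uniformOfFintype (Fin (w.length + 1))).bind fun m =>
      acceptReject α β hβ w (leftInsert w R m))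

/-- The law of a Markov chain with one-step law `T` started at `u` after `n` steps. -/
noncomputable def nStep {X : Type*} (T : X → PMF X) : ℕ → X → PMF X
  | 0, u => PMF.pure u
  | n + 1, u => (nStep T n u).bind T

/-- A probability distribution `φ` is stationary if `φ(u) = ∑_v Pr(v → u) φ(v)` for all `u`. -/
def IsStationary {X : Type*} (T : X → PMF X) (φ : PMF X) : Prop :=
  ∀ u, φ u = ∑' v, T v u * φ v

/-- The unnormalised weight `(|w| + 1)^(1 + α) β^|w|`. -/
noncomputable def weight {rels : Set (FreeGroup A)} (α β : ℝ) (w : State rels) : ℝ :=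
  (w.length + 1 : ℝ) ^ (1 + α) * β ^ w.length

/-- The cogrowth function: the number of freely reduced trivial words of length `n`. -/
noncomputable def cogrowth (rels : Set (FreeGroup A)) (n : ℕ) : ℕ :=
  Nat.card {w : State rels // w.length = n}

/-- The radius of convergence of the cogrowth series `∑ c(n) zⁿ`. -/
noncomputable def cogrowthRadius (rels : Set (FreeGroup A)) : ℝ≥0∞ :=
  (FormalMultilinearSeries.ofScalars ℝ fun n => (cogrowth rels n : ℝ)).radius

end TrivialWords

/-! The chain is reversible with respect to the weight. Conjugation by `x` is undone by `x⁻¹`, so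
the Metropolis factor balances it (`conj_balance`). Between distinct states, inserting `R` at `m` is
undone by inserting `R⁻¹` at the same `m`; the uniform choice of position contributes `1 / (|w| +
1)`, which lowers the exponent from `1 + α` to `α`, exactly the one in the acceptance rule
(`insert_balance`).

The chain is irreducible because trivial elements are products of conjugates of relators and their
inverses, and right multiplication by `c r c⁻¹` is a conjugation, an insertion at the end and a
conjugation back (`reflTransGen_adjacent_mul`). It is aperiodic because conjugation fixes the empty
word.

Convergence is an `L²(π)` argument (`IsReversible.tendsto_iterate`): the transition operator `T` is
a self-adjoint contraction, so the even powers `T^(2n) f` converge, and reversibility,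
irreducibility and one loop force the limit to be the constant mean of `f`. Uniqueness follows by
letting `n → ∞` in `φ = φ Tⁿ`. Summability holds inside the radius of convergence because a
polynomial factor does not change the radius. -/

namespace TrivialWords

/-! ### Reversible Markov chains on an arbitrary state space. -/

section MarkovChain

variable {X : Type*}

/-- `nStep` appends steps at the end; splitting off the first one instead exhibits the `n`-step law
as an iterate of the operator on functions. -/
theorem nStep_succ' (T : X → PMF X) (n : ℕ) (u : X) :
    nStep T (n + 1) u = (T u).bind (nStep T n) := by
  induction n generalizing u with
  | zero =>
    change (PMF.pure u).bind T = (T u).bind PMF.pure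
    rw [PMF.pure_bind, PMF.bind_pure]
  | succ n ih =>
    change (nStep T (n + 1) u).bind T = _
    rw [ih, PMF.bind_bind]
    rfl

/-- A probability mass function with real values. -/
structure IsProbVec (p : X → ℝ) : Prop where
  nonneg : ∀ x, 0 ≤ p x
  hasSum : HasSum p 1

theorem isProbVec_toReal (μ : PMF X) : IsProbVec fun x => (μ x).toReal where
  nonneg _ := ENNReal.toReal_nonneg
  hasSum := by
    have h := ENNReal.summable_toReal (f := μ) (by simp [μ.tsum_coe])
    have h2 := ENNReal.tsum_toReal_eq (f := μ) (fun a => μ.apply_ne_top a)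
    rw [μ.tsum_coe] at h2
    simpa [← h2] using h.hasSum

theorem IsProbVec.summable_mul {p : X → ℝ} (hp : IsProbVec p) {f : X → ℝ} {C : ℝ}
    (hf : ∀ x, |f x| ≤ C) : Summable fun x => p x * f x := by
  refine Summable.of_norm_bounded (hp.hasSum.summable.mul_right C) fun x => ?_
  rw [Real.norm_eq_abs, abs_mul, abs_of_nonneg (hp.nonneg x)]
  exact mul_le_mul_of_nonneg_left (hf x) (hp.nonneg x)

theorem IsProbVec.abs_tsum_mul_le {p : X → ℝ} (hp : IsProbVec p) {f : X → ℝ} {C : ℝ}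
    (hf : ∀ x, |f x| ≤ C) : |∑' x, p x * f x| ≤ C := by
  have h : HasSum (fun x => p x * C) C := by simpa using hp.hasSum.mul_right C
  rw [← Real.norm_eq_abs]
  refine tsum_of_norm_bounded h fun x => ?_
  rw [Real.norm_eq_abs, abs_mul, abs_of_nonneg (hp.nonneg x)]
  exact mul_le_mul_of_nonneg_left (hf x) (hp.nonneg x)

theorem IsProbVec.tendsto_tsum_mul {p : X → ℝ} (hp : IsProbVec p) {f : ℕ → X → ℝ} {g : X → ℝ}
    {C : ℝ} (hf : ∀ n x, |f n x| ≤ C) (hlim : ∀ x, Tendsto (fun n => f n x) atTop (𝓝 (g x))) :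
    Tendsto (fun n => ∑' x, p x * f n x) atTop (𝓝 (∑' x, p x * g x)) := by
  refine tendsto_tsum_of_dominated_convergence (hp.hasSum.summable.mul_right C)
    (fun x => (hlim x).const_mul _) (Eventually.of_forall fun n x => ?_)
  rw [Real.norm_eq_abs, abs_mul, abs_of_nonneg (hp.nonneg x)]
  exact mul_le_mul_of_nonneg_left (hf n x) (hp.nonneg x)

/-- A Markov kernel `K` which is reversible with respect to the probability vector `p`. -/
structure IsReversible (K : X → X → ℝ) (p : X → ℝ) : Prop where
  prob : IsProbVec p
  kernel : ∀ x, IsProbVec (K x)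
  balance : ∀ x y, p x * K x y = p y * K y x

/-- The action of a kernel on functions. -/
noncomputable def kernelOp (K : X → X → ℝ) (f : X → ℝ) (x : X) : ℝ := ∑' y, K x y * f y

theorem abs_kernelOp_le {K : X → X → ℝ} (hK : ∀ x, IsProbVec (K x)) {f : X → ℝ} {C : ℝ}
    (hf : ∀ x, |f x| ≤ C) (x : X) : |kernelOp K f x| ≤ C :=
  (hK x).abs_tsum_mul_le hf

theorem abs_kernelOp_iterate_le {K : X → X → ℝ} (hK : ∀ x, IsProbVec (K x)) {f : X → ℝ} {C : ℝ}
    (hf : ∀ x, |f x| ≤ C) (n : ℕ) (x : X) : |(kernelOp K)^[n] f x| ≤ C := by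
  induction n generalizing x with
  | zero => exact hf x
  | succ n ih =>
    rw [Function.iterate_succ_apply']
    exact abs_kernelOp_le hK ih x

theorem abs_mul_le_mul_of_abs_le {a b C D : ℝ} (ha : |a| ≤ C) (hb : |b| ≤ D) :
    |a * b| ≤ C * D := by
  rw [abs_mul]
  exact mul_le_mul ha hb (abs_nonneg _) ((abs_nonneg _).trans ha)

namespace IsReversible

variable {K : X → X → ℝ} {p : X → ℝ}

/-- The edge measure `p x * K x y` has total mass one, so bounded functions are integrable against
it; this licenses every exchange of sums below. -/
theorem summable_edge (hK : IsReversible K p) {F : X → X → ℝ} {C : ℝ}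
    (hF : ∀ x y, |F x y| ≤ C) :
    Summable fun z : X × X => p z.1 * (K z.1 z.2 * F z.1 z.2) := by
  have h1 : Summable fun z : X × X => p z.1 * K z.1 z.2 := by
    refine (summable_prod_of_nonneg fun z =>
      mul_nonneg (hK.prob.nonneg _) ((hK.kernel _).nonneg _)).2 ⟨fun x => ?_, ?_⟩
    · dsimp only
      exact (hK.kernel x).hasSum.summable.mul_left _
    · refine hK.prob.hasSum.summable.congr fun x => ?_
      dsimp only
      rw [tsum_mul_left, (hK.kernel x).hasSum.tsum_eq, mul_one]
  refine Summable.of_norm_bounded (h1.mul_right C) fun z => ?_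
  have h0 := mul_nonneg (hK.prob.nonneg z.1) ((hK.kernel z.1).nonneg z.2)
  rw [Real.norm_eq_abs, ← mul_assoc, abs_mul, abs_of_nonneg h0]
  exact mul_le_mul_of_nonneg_left (hF _ _) h0

theorem inner_kernelOp (hK : IsReversible K p) {f g : X → ℝ} {C D : ℝ}
    (hf : ∀ x, |f x| ≤ C) (hg : ∀ x, |g x| ≤ D) :
    ∑' x, p x * (kernelOp K f x * g x) = ∑' x, p x * (f x * kernelOp K g x) := by
  have hs := hK.summable_edge (F := fun x y => f y * g x)
    fun x y => abs_mul_le_mul_of_abs_le (hf y) (hg x)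
  calc ∑' x, p x * (kernelOp K f x * g x)
      = ∑' x, ∑' y, p x * (K x y * (f y * g x)) := by
        refine tsum_congr fun x => ?_
        rw [tsum_mul_left, kernelOp, ← tsum_mul_right]
        simp only [mul_assoc]
    _ = ∑' y, ∑' x, p x * (K x y * (f y * g x)) :=
        (Summable.tsum_comm (f := fun x y => p x * (K x y * (f y * g x))) hs).symm
    _ = ∑' y, ∑' x, f y * p y * (K y x * g x) := by
        refine tsum_congr fun y => tsum_congr fun x => ?_
        linear_combination f y * g x * hK.balance x y
    _ = _ := by
        refine tsum_congr fun y => ?_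
        rw [tsum_mul_left, kernelOp]
        ring

theorem tsum_kernelOp (hK : IsReversible K p) {f : X → ℝ} {C : ℝ} (hf : ∀ x, |f x| ≤ C) :
    ∑' x, p x * kernelOp K f x = ∑' x, p x * f x := by
  have h := hK.inner_kernelOp hf (g := fun _ => 1) (D := 1) (by simp)
  have h1 : kernelOp K (fun _ => 1) = fun _ => 1 := by
    funext x
    simp [kernelOp, (hK.kernel x).hasSum.tsum_eq]
  simpa [h1] using h

theorem tsum_kernelOp_iterate (hK : IsReversible K p) {f : X → ℝ} {C : ℝ}
    (hf : ∀ x, |f x| ≤ C) (n : ℕ) :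
    ∑' x, p x * (kernelOp K)^[n] f x = ∑' x, p x * f x := by
  induction n with
  | zero => rfl
  | succ n ih =>
    rw [Function.iterate_succ_apply', hK.tsum_kernelOp (abs_kernelOp_iterate_le hK.kernel hf n), ih]

/-- Expand the square under each `K x`, then use invariance of the mean of `f²`. In norms, the
expected one-step variance is `‖f‖² - ‖Tf‖²`: it shows that `T` contracts and detects equality. -/
theorem tsum_variance (hK : IsReversible K p) {f : X → ℝ} {C : ℝ} (hf : ∀ x, |f x| ≤ C) :
    ∑' x, p x * ∑' y, K x y * (f y - kernelOp K f x) ^ 2 =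
      ∑' x, p x * (f x * f x) - ∑' x, p x * (kernelOp K f x * kernelOp K f x) := by
  have hff : ∀ x, |f x * f x| ≤ C * C := fun x => abs_mul_le_mul_of_abs_le (hf x) (hf x)
  have hTf := abs_kernelOp_le hK.kernel hf
  have hTT : ∀ x, |kernelOp K f x * kernelOp K f x| ≤ C * C :=
    fun x => abs_mul_le_mul_of_abs_le (hTf x) (hTf x)
  rw [← hK.tsum_kernelOp hff, ← Summable.tsum_sub
    (hK.prob.summable_mul (abs_kernelOp_le hK.kernel hff)) (hK.prob.summable_mul hTT)]
  refine tsum_congr fun x => ?_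
  rw [← mul_sub]
  congr 1
  have h1 := ((hK.kernel x).summable_mul hff).hasSum
  have h2 := ((hK.kernel x).summable_mul hf).hasSum
  have h3 := (h1.sub (h2.mul_left (2 * kernelOp K f x))).add
    ((hK.kernel x).hasSum.mul_left (kernelOp K f x * kernelOp K f x))
  convert h3.tsum_eq using 1
  · exact tsum_congr fun y => by ring
  · simp only [kernelOp]
    ring

theorem inner_iterate (hK : IsReversible K p) {f : X → ℝ} {C : ℝ} (hf : ∀ x, |f x| ≤ C)
    (n m : ℕ) : ∑' x, p x * ((kernelOp K)^[n] f x * (kernelOp K)^[m] f x) =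
      ∑' x, p x * ((kernelOp K)^[n + m] f x * f x) := by
  induction m generalizing n with
  | zero => rfl
  | succ m ih =>
    have hb := abs_kernelOp_iterate_le hK.kernel hf
    rw [Function.iterate_succ_apply' _ m, ← hK.inner_kernelOp (hb n) (hb m),
      ← Function.iterate_succ_apply' (kernelOp K), ih]
    congr! 5
    omega

theorem antitone_inner_iterate (hK : IsReversible K p) {f : X → ℝ} {C : ℝ}
    (hf : ∀ x, |f x| ≤ C) :
    Antitone fun n => ∑' x, p x * ((kernelOp K)^[n] f x * (kernelOp K)^[n] f x) := by
  refine antitone_nat_of_succ_le fun n => ?_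
  have h := hK.tsum_variance (abs_kernelOp_iterate_le hK.kernel hf n)
  have h0 : 0 ≤ ∑' x, p x * ∑' y, K x y *
      ((kernelOp K)^[n] f y - kernelOp K ((kernelOp K)^[n] f) x) ^ 2 :=
    tsum_nonneg fun x => mul_nonneg (hK.prob.nonneg x) (tsum_nonneg fun y =>
      mul_nonneg ((hK.kernel x).nonneg y) (sq_nonneg _))
  rw [Function.iterate_succ_apply']
  linarith

/-- With `a n = ‖Tⁿf‖²`, self-adjointness gives `‖T^(2n)f - T^(2m)f‖² = a (2n) + a (2m) - 2 a (n +
m)`, which is small since `a` decreases to a limit. Even powers make the cross term again a value of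
`a`; positivity of `p x` turns the `L²` bound into a pointwise one. -/
theorem cauchySeq_iterate (hK : IsReversible K p) (hp : ∀ x, p x ≠ 0) {f : X → ℝ} {C : ℝ}
    (hf : ∀ x, |f x| ≤ C) (x : X) :
    CauchySeq fun n => (kernelOp K)^[2 * n] f x := by
  have hb := abs_kernelOp_iterate_le hK.kernel hf
  have hpx : 0 < p x := lt_of_le_of_ne (hK.prob.nonneg x) (hp x).symm
  set a : ℕ → ℝ := fun n => ∑' x, p x * ((kernelOp K)^[n] f x * (kernelOp K)^[n] f x) with ha
  have hlim : Tendsto a atTop (𝓝 (⨅ n, a n)) := by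
    refine tendsto_atTop_ciInf (hK.antitone_inner_iterate hf) ⟨0, ?_⟩
    rintro _ ⟨n, rfl⟩
    exact tsum_nonneg fun x => mul_nonneg (hK.prob.nonneg x) (mul_self_nonneg _)
  have key : ∀ n m, p x * ((kernelOp K)^[2 * n] f x - (kernelOp K)^[2 * m] f x) ^ 2 ≤
      a (2 * n) + a (2 * m) - 2 * a (n + m) := by
    intro n m
    have hs := fun i j => (hK.prob.summable_mul fun x =>
      abs_mul_le_mul_of_abs_le (hb i x) (hb j x)).hasSum
    have h := ((hs (2 * n) (2 * n)).add (hs (2 * m) (2 * m))).sub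
      ((hs (2 * n) (2 * m)).mul_left 2)
    have hnm : ∑' x, p x * ((kernelOp K)^[2 * n] f x * (kernelOp K)^[2 * m] f x) = a (n + m) := by
      simp only [ha]
      rw [hK.inner_iterate hf, hK.inner_iterate hf]
      congr! 5
      omega
    rw [hnm] at h
    refine le_trans (le_of_eq ?_) (le_hasSum h x fun y _ => ?_)
    · ring
    · nlinarith [mul_nonneg (hK.prob.nonneg y)
        (sq_nonneg ((kernelOp K)^[2 * n] f y - (kernelOp K)^[2 * m] f y))]
  rw [Metric.cauchySeq_iff]
  intro ε hε
  -- The three values of `a` enter with total weight `1 + 1 + 2 = 4`.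
  have hδ : 0 < p x * ε ^ 2 / 4 := by positivity
  obtain ⟨N, hN⟩ := Metric.tendsto_atTop.1 hlim _ hδ
  refine ⟨N, fun n hn m hm => ?_⟩
  have h1 := abs_lt.1 (hN (2 * n) (by omega))
  have h2 := abs_lt.1 (hN (2 * m) (by omega))
  have h3 := abs_lt.1 (hN (n + m) (by omega))
  have h4 := key n m
  rw [Real.dist_eq]
  refine abs_lt_of_sq_lt_sq (lt_of_mul_lt_mul_left ?_ hpx.le) hε.le
  linarith

/-- Powers of an ergodic reversible kernel converge to the stationary mean. -/
theorem tendsto_iterate (hK : IsReversible K p) (hp : ∀ x, p x ≠ 0) {o : X} (ho : K o o ≠ 0)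
    (hreach : ∀ x, Relation.ReflTransGen (fun x y => K x y ≠ 0) o x) {f : X → ℝ} {C : ℝ}
    (hf : ∀ x, |f x| ≤ C) (x : X) :
    Tendsto (fun n => (kernelOp K)^[n] f x) atTop (𝓝 (∑' y, p y * f y)) := by
  have hb := abs_kernelOp_iterate_le hK.kernel hf
  choose h hh using fun x => cauchySeq_tendsto_of_complete (hK.cauchySeq_iterate hp hf x)
  have hhb : ∀ x, |h x| ≤ C := fun x =>
    le_of_tendsto (hh x).abs (Eventually.of_forall fun n => hb _ x)
  have hodd : ∀ x, Tendsto (fun n => (kernelOp K)^[2 * n + 1] f x) atTop (𝓝 (kernelOp K h x)) := by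
    intro x
    simp only [Function.iterate_succ_apply']
    exact (hK.kernel x).tendsto_tsum_mul (fun n => hb _) hh
  have hinv : kernelOp K (kernelOp K h) = h := by
    funext x
    refine tendsto_nhds_unique ?_ ((tendsto_add_atTop_iff_nat 1).2 (hh x))
    have h2 : ∀ n, (kernelOp K)^[2 * (n + 1)] f x =
        kernelOp K ((kernelOp K)^[2 * n + 1] f) x := fun n => by
      rw [← Function.iterate_succ_apply' (kernelOp K)]
      rfl
    simp only [h2]
    exact (hK.kernel x).tendsto_tsum_mul (fun n => hb _) hodd
  have hTb := abs_kernelOp_le hK.kernel hhb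
  -- Since `T²h = h`, self-adjointness gives `‖Th‖² = ⟨h, T²h⟩ = ‖h‖²`, so no variance is lost.
  have hvar : ∑' x, p x * ∑' y, K x y * (h y - kernelOp K h x) ^ 2 = 0 := by
    rw [hK.tsum_variance hhb, hK.inner_kernelOp hhb hTb, hinv, sub_self]
  have hdiff : ∀ x y, |(h y - kernelOp K h x) ^ 2| ≤ (C + C) * (C + C) := fun x y => by
    rw [sq]
    have := (abs_sub _ _).trans (add_le_add (hhb y) (hTb x))
    exact abs_mul_le_mul_of_abs_le this this
  have hedge : ∀ x y, K x y ≠ 0 → h y = kernelOp K h x := by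
    intro x y hxy
    have hs := hK.summable_edge hdiff
    have hz : ∑' z : X × X, p z.1 * (K z.1 z.2 * (h z.2 - kernelOp K h z.1) ^ 2) = 0 := by
      rw [hs.tsum_prod]
      simpa only [tsum_mul_left] using hvar
    have h0 := (hasSum_zero_iff_of_nonneg fun z : X × X => mul_nonneg (hK.prob.nonneg z.1)
      (mul_nonneg ((hK.kernel z.1).nonneg z.2) (sq_nonneg _))).1 (hz ▸ hs.hasSum)
    have h1 := congrFun h0 (x, y)
    simp only [Pi.zero_apply, mul_eq_zero, hp x, hxy, false_or, pow_eq_zero_iff,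
      ne_eq, OfNat.ofNat_ne_zero, not_false_eq_true] at h1
    linarith
  have hsymm : ∀ x y, K x y ≠ 0 → K y x ≠ 0 := fun x y hxy hyx =>
    mul_ne_zero (hp x) hxy (by rw [hK.balance, hyx, mul_zero])
  -- Along an edge `h` and `Th` swap roles, so both are carried; the loop at `o` makes them agree
  -- there and so excludes period two.
  have hconst : ∀ x, h x = h o ∧ kernelOp K h x = h o := by
    intro x
    induction hreach x with
    | refl => exact ⟨rfl, (hedge o o ho).symm⟩
    | tail _ hxy ih =>
      exact ⟨(hedge _ _ hxy).trans ih.2, (hedge _ _ (hsymm _ _ hxy)).symm.trans ih.1⟩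
  -- Every `T^(2n) f` has the mean of `f`, hence so does its constant limit.
  have hval : h o = ∑' y, p y * f y := by
    have h1 : Tendsto (fun n => ∑' y, p y * (kernelOp K)^[2 * n] f y) atTop
        (𝓝 (∑' y, p y * h y)) := hK.prob.tendsto_tsum_mul (fun n => hb _) hh
    simp only [hK.tsum_kernelOp_iterate hf, fun y => (hconst y).1, tsum_mul_right,
      hK.prob.hasSum.tsum_eq, one_mul] at h1
    exact tendsto_nhds_unique h1 tendsto_const_nhds
  rw [← hval]
  have he : Tendsto (fun n => (kernelOp K)^[2 * n] f x) atTop (𝓝 (h o)) := (hconst x).1 ▸ hh x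
  have ho' : Tendsto (fun n => (kernelOp K)^[2 * n + 1] f x) atTop (𝓝 (h o)) :=
    (hconst x).2 ▸ hodd x
  rw [Metric.tendsto_atTop] at he ho' ⊢
  intro ε hε
  obtain ⟨N, hN⟩ := he ε hε
  obtain ⟨M, hM⟩ := ho' ε hε
  refine ⟨2 * (N + M), fun n hn => ?_⟩
  obtain ⟨k, rfl | rfl⟩ := Nat.even_or_odd' n
  · exact hN k (by omega)
  · exact hM k (by omega)

end IsReversible

theorem toReal_nStep [DecidableEq X] (T : X → PMF X) (n : ℕ) (u v : X) :
    (nStep T n u v).toReal =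
      (kernelOp fun x y => (T x y).toReal)^[n] (fun x => if x = v then 1 else 0) u := by
  induction n generalizing u with
  | zero =>
    simp only [nStep, PMF.pure_apply, Function.iterate_zero, id_eq, eq_comm (a := v)]
    split_ifs <;> rfl
  | succ n ih =>
    rw [nStep_succ', PMF.bind_apply, Function.iterate_succ_apply', kernelOp,
      ENNReal.tsum_toReal_eq fun y =>
        ENNReal.mul_ne_top ((T u).apply_ne_top y) ((nStep T n y).apply_ne_top v)]
    exact tsum_congr fun y => by rw [ENNReal.toReal_mul, ih]

theorem tendsto_nStep (T : X → PMF X) (π : PMF X) (hπ : ∀ x, π x ≠ 0)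
    (hrev : ∀ x y, π x * T x y = π y * T y x) {o : X} (ho : T o o ≠ 0)
    (hreach : ∀ x, Relation.ReflTransGen (fun x y => T x y ≠ 0) o x) (u v : X) :
    Tendsto (fun n => nStep T n u v) atTop (𝓝 (π v)) := by
  classical
  have hne : ∀ (μ : PMF X) x, (μ x).toReal ≠ 0 ↔ μ x ≠ 0 := fun μ x => by
    simp [ENNReal.toReal_eq_zero_iff, μ.apply_ne_top x]
  have hK : IsReversible (fun x y => (T x y).toReal) fun x => (π x).toReal :=
    { prob := isProbVec_toReal π
      kernel := fun x => isProbVec_toReal (T x)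
      balance := fun x y => by
        simp only [← ENNReal.toReal_mul, hrev x y] }
  rw [← ENNReal.tendsto_toReal_iff (fun n => PMF.apply_ne_top _ _) (PMF.apply_ne_top _ _)]
  simp only [toReal_nStep]
  have h := hK.tendsto_iterate (fun x => (hne π x).2 (hπ x)) ((hne _ _).2 ho)
    (by simpa only [hne] using hreach) (f := fun x => if x = v then 1 else 0) (C := 1)
    (fun x => by split_ifs <;> simp) u
  simpa using h

theorem isStationary_of_reversible (T : X → PMF X) (π : PMF X)
    (hrev : ∀ x y, π x * T x y = π y * T y x) : IsStationary T π := fun u => by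
  calc π u = π u * ∑' v, T u v := by rw [(T u).tsum_coe, mul_one]
    _ = ∑' v, T v u * π v := by
      rw [← ENNReal.tsum_mul_left]
      exact tsum_congr fun v => by rw [hrev, mul_comm]

theorem IsStationary.nStep {T : X → PMF X} {φ : PMF X} (h : IsStationary T φ) (n : ℕ) (u : X) :
    φ u = ∑' v, φ v * nStep T n v u := by
  classical
  induction n generalizing u with
  | zero => simp [TrivialWords.nStep, PMF.pure_apply]
  | succ n ih =>
    have h1 : φ.bind T = φ := PMF.ext fun u => by
      rw [PMF.bind_apply, h u]
      exact tsum_congr fun v => mul_comm _ _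
    have h2 : φ.bind (TrivialWords.nStep T n) = φ := PMF.ext fun u => (ih u).symm
    have h3 : φ.bind (TrivialWords.nStep T (n + 1)) = φ := by
      simp only [TrivialWords.nStep]
      rw [← PMF.bind_bind, h2, h1]
    conv_lhs => rw [← h3, PMF.bind_apply]

/-- Dominated convergence in `φ u = ∑' v, φ v * nStep T n v u`: the right side tends to `π u` times
the total mass of `φ`. -/
theorem IsStationary.eq_of_tendsto {T : X → PMF X} {φ π : PMF X} (h : IsStationary T φ)
    (hlim : ∀ u v, Tendsto (fun n => TrivialWords.nStep T n u v) atTop (𝓝 (π v))) : φ = π := by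
  ext u
  rw [← ENNReal.toReal_eq_toReal_iff' (φ.apply_ne_top u) (π.apply_ne_top u)]
  have hφ := isProbVec_toReal φ
  have h1 : ∀ n, (φ u).toReal =
      ∑' v, (φ v).toReal * (TrivialWords.nStep T n v u).toReal := fun n => by
    rw [h.nStep n u, ENNReal.tsum_toReal_eq fun y =>
      ENNReal.mul_ne_top (φ.apply_ne_top y) (PMF.apply_ne_top _ _)]
    simp only [ENNReal.toReal_mul]
  have h2 := hφ.tendsto_tsum_mul (f := fun n v => (TrivialWords.nStep T n v u).toReal)
    (g := fun _ => (π u).toReal) (C := 1)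
    (fun n v => by
      rw [abs_of_nonneg ENNReal.toReal_nonneg]
      exact ENNReal.toReal_le_of_le_ofReal zero_le_one (by simpa using PMF.coe_le_one _ _))
    (fun v => (ENNReal.tendsto_toReal_iff (fun n => PMF.apply_ne_top _ _)
      (PMF.apply_ne_top _ _)).2 (hlim v u))
  simp only [← h1, tsum_mul_right, hφ.hasSum.tsum_eq, one_mul] at h2
  exact tendsto_nhds_unique tendsto_const_nhds h2

end MarkovChain
-- States as free group elements, and the weights.
section General

variable {A : Type*} {rels : Set (FreeGroup A)}

/-- The element of the free group represented by a state. -/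
def State.toFreeGroup (w : State rels) : FreeGroup A := FreeGroup.mk w.1

theorem toFreeGroup_mem_normalClosure (w : State rels) :
    w.toFreeGroup ∈ Subgroup.normalClosure rels :=
  PresentedGroup.mk_eq_one_iff.1 w.2.2

theorem mk_letterInv (x : A × Bool) : FreeGroup.mk [letterInv x] = (FreeGroup.mk [x])⁻¹ := by
  simp [letterInv, FreeGroup.invRev]

theorem letterInv_involutive : Function.Involutive (letterInv : A × Bool → A × Bool) :=
  fun x => by simp [letterInv]

/-- The words of `w` and `w'` share their last `m` letters, and the word of `w'` before them
represents the product of the word of `w` before them and `g`. -/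
def InsertionRel (w w' : State rels) (g : FreeGroup A) (m : ℕ) : Prop :=
  m ≤ w.length ∧ m ≤ w'.length ∧ w.1.drop (w.length - m) = w'.1.drop (w'.length - m) ∧
    FreeGroup.mk (w'.1.take (w'.length - m)) = FreeGroup.mk (w.1.take (w.length - m)) * g

theorem InsertionRel.symm {w w' : State rels} {g : FreeGroup A} {m : ℕ}
    (h : InsertionRel w w' g m) : InsertionRel w' w g⁻¹ m :=
  ⟨h.2.1, h.1, h.2.2.1.symm, by rw [h.2.2.2, mul_inv_cancel_right]⟩

theorem weight_pos {α β : ℝ} (hβ : 0 < β) (w : State rels) : 0 < weight α β w := by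
  unfold weight
  positivity

theorem acceptProb_one_add (α β : ℝ) (w w' : State rels) :
    acceptProb (1 + α) β w w' = min 1 (weight α β w' / weight α β w) := by
  rw [acceptProb, weight, weight, div_mul_div_comm]

/-- Both sides are the minimum of the two weights. -/
theorem weight_mul_acceptProb_comm (α : ℝ) {β : ℝ} (hβ : 0 < β) (w w' : State rels) :
    weight α β w * acceptProb (1 + α) β w w' = weight α β w' * acceptProb (1 + α) β w' w := by
  have h := weight_pos (α := α) hβ w
  have h' := weight_pos (α := α) hβ w'
  rw [acceptProb_one_add, acceptProb_one_add, mul_min_of_nonneg _ _ h.le,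
    mul_min_of_nonneg _ _ h'.le, mul_div_cancel₀ _ h.ne', mul_div_cancel₀ _ h'.ne',
    mul_one, mul_one, min_comm]

theorem acceptProb_pos (e : ℝ) {β : ℝ} (hβ : 0 < β) (w w' : State rels) :
    0 < acceptProb e β w w' := by
  unfold acceptProb
  positivity

theorem weight_eq (α β : ℝ) (w : State rels) :
    weight α β w = (w.length + 1) * weight (α - 1) β w := by
  rw [weight, weight, Real.rpow_add (by positivity), Real.rpow_one, add_sub_cancel]
  ring

theorem mix_apply {X : Type*} (p : ℝ) (hp : p ∈ Set.Icc (0 : ℝ) 1) (μ ν : PMF X) (x : X) :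
    mix p hp μ ν x = ENNReal.ofReal p * μ x + ENNReal.ofReal (1 - p) * ν x :=
  rfl

end General

/-! ### Reversing the elementary moves. -/

section Moves

variable {A : Type*} [DecidableEq A] {rels : Set (FreeGroup A)}

theorem State.toFreeGroup_injective :
    Function.Injective (State.toFreeGroup : State rels → FreeGroup A) := fun v w h => by
  refine Subtype.ext ?_
  rw [← v.2.1.reduce_eq, ← w.2.1.reduce_eq]
  exact FreeGroup.reduce.sound h

/-- The state given by a trivial element of the free group. -/
def State.ofFreeGroup (g : FreeGroup A) (hg : PresentedGroup.mk rels g = 1) : State rels :=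
  ⟨g.toWord, FreeGroup.isReduced_toWord, by rwa [FreeGroup.mk_toWord]⟩

theorem State.toFreeGroup_ofFreeGroup (g : FreeGroup A) (hg : PresentedGroup.mk rels g = 1) :
    (State.ofFreeGroup g hg).toFreeGroup = g :=
  FreeGroup.mk_toWord

theorem relatorInv_involutive :
    Function.Involutive (relatorInv : relatorSet rels → relatorSet rels) :=
  fun _ => Subtype.ext FreeGroup.invRev_invRev

theorem toFreeGroup_conjMove (w : State rels) (x : A × Bool) :
    (conjMove w x).toFreeGroup = FreeGroup.mk [x] * w.toFreeGroup * (FreeGroup.mk [x])⁻¹ := by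
  rw [State.toFreeGroup, conjMove, mk_reduce, ← mk_letterInv, State.toFreeGroup,
    FreeGroup.mul_mk, FreeGroup.mul_mk]
  rfl

theorem conjMove_eq_iff (w w' : State rels) (x : A × Bool) :
    conjMove w x = w' ↔ conjMove w' (letterInv x) = w := by
  rw [← State.toFreeGroup_injective.eq_iff, ← State.toFreeGroup_injective.eq_iff,
    toFreeGroup_conjMove, toFreeGroup_conjMove, mk_letterInv]
  constructor <;> rintro h <;> rw [← h] <;> group

theorem leftInsert_val {w : State rels} {R : relatorSet rels} {m : Fin (w.length + 1)}
    (h : FreeGroup.IsReduced (FreeGroup.reduce (w.1.take (w.length - m) ++ R.1) ++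
      w.1.drop (w.length - m))) :
    (leftInsert w R m).1 = FreeGroup.reduce (w.1.take (w.length - m) ++ R.1) ++
      w.1.drop (w.length - m) :=
  congrArg Subtype.val (dif_pos h.reduce_eq)

theorem leftInsert_eq_self {w : State rels} {R : relatorSet rels} {m : Fin (w.length + 1)}
    (h : ¬ FreeGroup.IsReduced (FreeGroup.reduce (w.1.take (w.length - m) ++ R.1) ++
      w.1.drop (w.length - m))) : leftInsert w R m = w :=
  dif_neg fun h' => h (FreeGroup.IsReduced.of_reduce_eq h')

/-- For `w ≠ w'` the insertion was not rejected, so it is captured by `InsertionRel`, which is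
visibly symmetric under `g ↦ g⁻¹`. -/
theorem leftInsert_eq_iff {w w' : State rels} (hne : w ≠ w') (R : relatorSet rels)
    (m : Fin (w.length + 1)) :
    leftInsert w R m = w' ↔ InsertionRel w w' (FreeGroup.mk R.1) m := by
  have hm : (m : ℕ) ≤ w.length := Nat.lt_succ_iff.1 m.2
  have hlen : (w.1.drop (w.length - m)).length = m := by
    rw [List.length_drop]
    change w.length - (w.length - m) = m
    omega
  constructor
  · intro h
    by_cases hred : FreeGroup.IsReduced
        (FreeGroup.reduce (w.1.take (w.length - m) ++ R.1) ++ w.1.drop (w.length - m))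
    · have hw' : w'.1 = FreeGroup.reduce (w.1.take (w.length - m) ++ R.1) ++
          w.1.drop (w.length - m) := by rw [← h, leftInsert_val hred]
      have hl : w'.length =
          (FreeGroup.reduce (w.1.take (w.length - m) ++ R.1)).length + m := by
        rw [State.length, hw', List.length_append, hlen]
      refine ⟨hm, by omega, ?_, ?_⟩
      · rw [hl, Nat.add_sub_cancel, hw', List.drop_left]
      · rw [hl, Nat.add_sub_cancel, hw', List.take_left, mk_reduce, FreeGroup.mul_mk]
    · exact absurd ((leftInsert_eq_self hred).symm.trans h) hne
  · rintro ⟨-, hm', hd, ht⟩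
    -- A prefix of the reduced word `w'` is reduced, so it is the only reduced word for its group
    -- element.
    have hu : FreeGroup.reduce (w.1.take (w.length - m) ++ R.1) =
        w'.1.take (w'.length - m) := by
      rw [FreeGroup.mul_mk] at ht
      rw [← FreeGroup.reduce.sound ht]
      exact (w'.2.1.infix (List.take_prefix _ _).isInfix).reduce_eq
    have happ : FreeGroup.reduce (w.1.take (w.length - m) ++ R.1) ++
        w.1.drop (w.length - m) = w'.1 := by
      rw [hu, hd, List.take_append_drop]
    exact Subtype.ext ((leftInsert_val (by rw [happ]; exact w'.2.1)).trans happ)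

theorem sum_leftInsert {M : Type*} [AddCommMonoid M] [DecidableEq (State rels)]
    {w w' : State rels} (hne : w ≠ w') (R : relatorSet rels) (c : M) :
    ∑ m, (if leftInsert w R m = w' then c else 0) =
      ∑ m, if leftInsert w' (relatorInv R) m = w then c else 0 := by
  have hinv : FreeGroup.mk (relatorInv R).1 = (FreeGroup.mk R.1)⁻¹ := (FreeGroup.inv_mk).symm
  have key : ∀ m : ℕ, InsertionRel w' w (FreeGroup.mk (relatorInv R).1) m ↔
      InsertionRel w w' (FreeGroup.mk R.1) m := fun m => by
    rw [hinv]
    exact ⟨fun h => by simpa using h.symm, InsertionRel.symm⟩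
  classical
  simp only [leftInsert_eq_iff hne, leftInsert_eq_iff hne.symm, key]
  rw [← Finset.sum_filter, ← Finset.sum_filter]
  refine Finset.sum_bij' (fun m hm => ⟨m, Nat.lt_succ_iff.2 (Finset.mem_filter.1 hm).2.2.1⟩)
    (fun m hm => ⟨m, Nat.lt_succ_iff.2 (Finset.mem_filter.1 hm).2.1⟩) ?_ ?_ ?_ ?_ ?_ <;> simp

/-- Positions count from the right, so position `0` is the end of the word, where no letter can
obstruct the insertion. -/
theorem toFreeGroup_leftInsert_zero (w : State rels) (R : relatorSet rels) :
    (leftInsert w R 0).toFreeGroup = w.toFreeGroup * FreeGroup.mk R.1 := by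
  have h1 : w.1.take w.length = w.1 := List.take_length
  have h2 : w.1.drop w.length = [] := List.drop_length
  have hred : FreeGroup.IsReduced (FreeGroup.reduce (w.1.take (w.length - (0 : Fin (w.length + 1))) ++
      R.1) ++
      w.1.drop (w.length - (0 : Fin (w.length + 1)))) := by
    rw [Fin.val_zero, Nat.sub_zero, h2, List.append_nil]
    exact isReduced_reduce _
  rw [State.toFreeGroup, leftInsert_val hred, Fin.val_zero, Nat.sub_zero, h1, h2, List.append_nil,
    mk_reduce, State.toFreeGroup, FreeGroup.mul_mk]

end Moves

/-! ### Detailed balance and positivity of the moves. -/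

section Chain

variable {A : Type*} [DecidableEq A] {rels : Set (FreeGroup A)}

theorem acceptReject_apply_of_ne [DecidableEq (State rels)] (e β : ℝ)
    (hβ : β ∈ Set.Ioo (0 : ℝ) 1) {w w' : State rels}
    (hne : w ≠ w') (z : State rels) : acceptReject e β hβ w z w' =
      if z = w' then ENNReal.ofReal (acceptProb e β w w') else 0 := by
  rw [acceptReject, mix_apply, PMF.pure_apply, PMF.pure_apply, if_neg hne.symm]
  by_cases h : z = w'
  · simp [h]
  · simp [h, Ne.symm h]

theorem acceptReject_self_ne_zero (e β : ℝ) (hβ : β ∈ Set.Ioo (0 : ℝ) 1) (w w' : State rels) :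
    acceptReject e β hβ w w' w' ≠ 0 := by
  rw [acceptReject, mix_apply, PMF.pure_apply, if_pos rfl, mul_one]
  exact fun h => (ENNReal.ofReal_pos.2 (acceptProb_pos e hβ.1 w w')).ne' (add_eq_zero.1 h).1

variable (α : ℝ) {β : ℝ} (hβ : β ∈ Set.Ioo (0 : ℝ) 1) {P : PMF (relatorSet rels)}

theorem insert_balance (hP : ∀ R, P R = P (relatorInv R)) (w w' : State rels) (hne : w ≠ w') :
    ENNReal.ofReal (weight α β w) * (P.bind fun R =>
      (PMF.uniformOfFintype (Fin (w.length + 1))).bind fun m =>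
        acceptReject α β hβ w (leftInsert w R m)) w' =
    ENNReal.ofReal (weight α β w') * (P.bind fun R =>
      (PMF.uniformOfFintype (Fin (w'.length + 1))).bind fun m =>
        acceptReject α β hβ w' (leftInsert w' R m)) w := by
  classical
  have key : ∀ (v v' : State rels), v ≠ v' → ∀ R,
      ENNReal.ofReal (weight α β v) * (P R *
        ((PMF.uniformOfFintype (Fin (v.length + 1))).bind fun m =>
          acceptReject α β hβ v (leftInsert v R m)) v') =
      P R * ∑ m, if leftInsert v R m = v' then
        ENNReal.ofReal (weight (α - 1) β v * acceptProb α β v v') else 0 := by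
    intro v v' hv R
    have hl : (0 : ℝ) < v.length + 1 := by positivity
    rw [mul_left_comm, PMF.bind_apply, tsum_fintype]
    congr 1
    rw [Finset.mul_sum]
    refine Finset.sum_congr rfl fun m _ => ?_
    rw [acceptReject_apply_of_ne _ _ _ hv, PMF.uniformOfFintype_apply, Fintype.card_fin]
    split_ifs
    · have hc : ((v.length + 1 : ℕ) : ℝ≥0∞)⁻¹ = ENNReal.ofReal (v.length + 1 : ℝ)⁻¹ := by
        rw [ENNReal.ofReal_inv_of_pos hl, ← Nat.cast_succ, ENNReal.ofReal_natCast]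
      rw [hc, ← ENNReal.ofReal_mul (by positivity),
        ← ENNReal.ofReal_mul (weight_pos hβ.1 _).le, weight_eq]
      congr 1
      field_simp
    · simp
  -- Pair the choice of `R` from `w` with that of `R⁻¹` from `w'`.
  rw [PMF.bind_apply, PMF.bind_apply, ← relatorInv_involutive.toPerm.tsum_eq (fun R => P R *
      ((PMF.uniformOfFintype (Fin (w'.length + 1))).bind fun m =>
        acceptReject α β hβ w' (leftInsert w' R m)) w),
    ← ENNReal.tsum_mul_left, ← ENNReal.tsum_mul_left]
  refine tsum_congr fun R => ?_
  have hacc := weight_mul_acceptProb_comm (α - 1) hβ.1 w w'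
  rw [add_sub_cancel] at hacc
  rw [key w w' hne, key w' w hne.symm, Function.Involutive.coe_toPerm, ← hP R,
    sum_leftInsert hne, hacc]

variable [Fintype A] [Nonempty A] {pc : ℝ} (hpc : pc ∈ Set.Ioo (0 : ℝ) 1)

theorem conj_balance (w w' : State rels) (hne : w ≠ w') :
    ENNReal.ofReal (weight α β w) * ((PMF.uniformOfFintype (A × Bool)).bind fun x =>
        acceptReject (1 + α) β hβ w (conjMove w x)) w' =
      ENNReal.ofReal (weight α β w') * ((PMF.uniformOfFintype (A × Bool)).bind fun x =>
        acceptReject (1 + α) β hβ w' (conjMove w' x)) w := by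
  classical
  rw [PMF.bind_apply, PMF.bind_apply, ← letterInv_involutive.toPerm.tsum_eq (fun x =>
    PMF.uniformOfFintype (A × Bool) x * acceptReject (1 + α) β hβ w' (conjMove w' x) w),
    ← ENNReal.tsum_mul_left, ← ENNReal.tsum_mul_left]
  refine tsum_congr fun x => ?_
  simp only [acceptReject_apply_of_ne _ _ _ hne, acceptReject_apply_of_ne _ _ _ hne.symm,
    PMF.uniformOfFintype_apply, conjMove_eq_iff w w', Function.Involutive.coe_toPerm]
  split_ifs
  · rw [mul_left_comm, mul_left_comm (ENNReal.ofReal (weight α β w')),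
      ← ENNReal.ofReal_mul (weight_pos hβ.1 _).le, ← ENNReal.ofReal_mul (weight_pos hβ.1 _).le,
      weight_mul_acceptProb_comm α hβ.1]
  · simp

theorem step_balance (hP : ∀ R, P R = P (relatorInv R)) (w w' : State rels) :
    ENNReal.ofReal (weight α β w) * step pc hpc α β hβ P w w' =
      ENNReal.ofReal (weight α β w') * step pc hpc α β hβ P w' w := by
  obtain rfl | hne := eq_or_ne w w'
  · rfl
  rw [step, step, mix_apply, mix_apply, mul_add, mul_add, mul_left_comm,
    conj_balance α hβ w w' hne, mul_left_comm, mul_left_comm _ (ENNReal.ofReal (1 - pc)),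
    insert_balance α hβ hP w w' hne, mul_left_comm _ (ENNReal.ofReal (1 - pc))]

theorem step_conjMove_ne_zero (w : State rels) (x : A × Bool) :
    step pc hpc α β hβ P w (conjMove w x) ≠ 0 := by
  rw [step, mix_apply]
  refine fun h => mul_ne_zero (ENNReal.ofReal_pos.2 hpc.1).ne' ?_ (add_eq_zero.1 h).1
  rw [← PMF.mem_support_iff, PMF.mem_support_bind_iff]
  exact ⟨x, PMF.mem_support_uniformOfFintype x, acceptReject_self_ne_zero _ _ hβ _ _⟩

theorem step_leftInsert_ne_zero (hP : ∀ R, P R ≠ 0) (w : State rels) (R : relatorSet rels)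
    (m : Fin (w.length + 1)) : step pc hpc α β hβ P w (leftInsert w R m) ≠ 0 := by
  rw [step, mix_apply]
  refine fun h => mul_ne_zero (ENNReal.ofReal_pos.2 (sub_pos.2 hpc.2)).ne' ?_ (add_eq_zero.1 h).2
  rw [← PMF.mem_support_iff, PMF.mem_support_bind_iff]
  refine ⟨R, hP R, ?_⟩
  rw [PMF.mem_support_bind_iff]
  exact ⟨m, PMF.mem_support_uniformOfFintype m, acceptReject_self_ne_zero _ _ hβ _ _⟩

end Chain

/-! ### Irreducibility. -/

section Irreducible

variable {A : Type*} [DecidableEq A] {rels : Set (FreeGroup A)}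

/-- Two states are adjacent if they are related by a conjugation or by a left-insertion at the
end of the word. -/
def Adjacent (w w' : State rels) : Prop :=
  (∃ x, conjMove w x = w') ∨ ∃ R, leftInsert w R 0 = w'

theorem Adjacent.symm {w w' : State rels} (h : Adjacent w w') : Adjacent w' w := by
  rcases h with ⟨x, hx⟩ | ⟨R, hR⟩
  · exact Or.inl ⟨letterInv x, (conjMove_eq_iff w w' x).1 hx⟩
  · refine Or.inr ⟨relatorInv R, State.toFreeGroup_injective ?_⟩
    rw [toFreeGroup_leftInsert_zero, ← hR, toFreeGroup_leftInsert_zero, relatorInv,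
      ← FreeGroup.inv_mk, mul_inv_cancel_right]

theorem reflTransGen_adjacent_conj (g : FreeGroup A) (w w' : State rels)
    (h : w'.toFreeGroup = g * w.toFreeGroup * g⁻¹) : Relation.ReflTransGen Adjacent w w' := by
  rw [← FreeGroup.mk_toWord (x := g)] at h
  generalize g.toWord = L at h
  induction L generalizing w' with
  | nil =>
    rw [show w' = w from State.toFreeGroup_injective (by simpa [← FreeGroup.one_eq_mk] using h)]
  | cons x L ih =>
    have hL : FreeGroup.mk (x :: L) = FreeGroup.mk [x] * FreeGroup.mk L := by
      rw [FreeGroup.mul_mk]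
      rfl
    have h1 : (conjMove w' (letterInv x)).toFreeGroup =
        FreeGroup.mk L * w.toFreeGroup * (FreeGroup.mk L)⁻¹ := by
      rw [toFreeGroup_conjMove, mk_letterInv, h, hL]
      group
    exact (ih _ h1).tail (Or.inl ⟨x, (conjMove_eq_iff _ _ x).2 rfl⟩)

/-- The normal closure is the subgroup generated by conjugates of relators. For `g = c r c⁻¹` the
path is `w → c⁻¹ w c → c⁻¹ w c r → w c r c⁻¹`; inverses are handled by reversing paths. -/
theorem reflTransGen_adjacent_mul {g : FreeGroup A} (hg : g ∈ Subgroup.normalClosure rels)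
    (w w' : State rels) (h : w'.toFreeGroup = w.toFreeGroup * g) :
    Relation.ReflTransGen Adjacent w w' := by
  induction hg using Subgroup.closure_induction generalizing w w' with
  | mem g hg =>
    obtain ⟨r, hr, c, rfl⟩ : ∃ r ∈ rels, ∃ c, c * r * c⁻¹ = g := by
      obtain ⟨r, hr, hrg⟩ := Group.mem_conjugatesOfSet_iff.1 hg
      exact ⟨r, hr, isConj_iff.1 hrg⟩
    have hR : r.toWord ∈ relatorSet rels :=
      ⟨r, hr, r.toWord, Or.inl (List.IsRotated.refl _), (FreeGroup.reduce_toWord r).symm⟩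
    have hcw : PresentedGroup.mk rels (c⁻¹ * w.toFreeGroup * c) = 1 := by
      have hw : PresentedGroup.mk rels w.toFreeGroup = 1 := w.2.2
      rw [map_mul, map_mul, hw, mul_one, ← map_mul, inv_mul_cancel, map_one]
    set v : State rels := State.ofFreeGroup _ hcw with hv
    have hv' := State.toFreeGroup_ofFreeGroup _ hcw
    rw [← hv] at hv'
    have h1 : Relation.ReflTransGen Adjacent w v :=
      reflTransGen_adjacent_conj c⁻¹ _ _ (by rw [hv', inv_inv])
    have h2 : Adjacent v (leftInsert v ⟨_, hR⟩ 0) := Or.inr ⟨_, rfl⟩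
    refine (h1.tail h2).trans (reflTransGen_adjacent_conj c _ _ ?_)
    rw [h, toFreeGroup_leftInsert_zero, hv', FreeGroup.mk_toWord]
    group
  | one =>
    rw [show w' = w from State.toFreeGroup_injective (by simpa using h)]
  | mul g k hg hk ihg ihk =>
    have hwg : PresentedGroup.mk rels (w.toFreeGroup * g) = 1 :=
      PresentedGroup.mk_eq_one_iff.2 (mul_mem (toFreeGroup_mem_normalClosure w) hg)
    have hv := State.toFreeGroup_ofFreeGroup _ hwg
    exact (ihg _ _ hv).trans (ihk _ _ (by rw [h, hv, mul_assoc]))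
  | inv g hg ih =>
    have : Std.Symm (Adjacent (rels := rels)) := ⟨fun _ _ => Adjacent.symm⟩
    exact Std.Symm.symm _ _ (ih w' w (by rw [h, inv_mul_cancel_right]))

theorem reflTransGen_adjacent (w w' : State rels) : Relation.ReflTransGen Adjacent w w' :=
  reflTransGen_adjacent_mul (mul_mem (inv_mem (toFreeGroup_mem_normalClosure w))
    (toFreeGroup_mem_normalClosure w')) w w' (mul_inv_cancel_left _ _).symm

theorem reflTransGen_step [Fintype A] [Nonempty A] {pc : ℝ} (hpc : pc ∈ Set.Ioo (0 : ℝ) 1)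
    (α : ℝ) {β : ℝ} (hβ : β ∈ Set.Ioo (0 : ℝ) 1) {P : PMF (relatorSet rels)}
    (hP : ∀ R, P R ≠ 0) (w w' : State rels) :
    Relation.ReflTransGen (fun u v => step pc hpc α β hβ P u v ≠ 0) w w' := by
  refine Relation.ReflTransGen.mono ?_ _ _ (reflTransGen_adjacent w w')
  rintro u _ (⟨x, rfl⟩ | ⟨R, rfl⟩)
  · exact step_conjMove_ne_zero α hβ hpc u x
  · exact step_leftInsert_ne_zero α hβ hpc hP u R 0

end Irreducible

/-! ### Summability of the weights and the cogrowth series. -/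

section Cogrowth

variable {A : Type*} [Fintype A] {rels : Set (FreeGroup A)}

theorem finite_length_eq (n : ℕ) : Finite {w : State rels // w.length = n} :=
  Finite.of_injective (β := List.Vector (A × Bool) n) (fun w => ⟨w.1.1, w.2⟩) fun _ _ h =>
    Subtype.ext (Subtype.ext (congrArg List.Vector.toList h))

theorem summable_pow_succ_mul_geometric (k : ℕ) {a : ℝ} (ha : a ∈ Set.Ioo (0 : ℝ) 1) :
    Summable fun n : ℕ => ((n : ℝ) + 1) ^ k * a ^ n := by
  have h := (summable_nat_add_iff 1).2 (summable_pow_mul_geometric_of_norm_lt_one (R := ℝ) k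
    (r := a) (by rw [Real.norm_of_nonneg ha.1.le]; exact ha.2))
  refine (h.mul_left a⁻¹).congr fun n => ?_
  rw [pow_succ', Nat.cast_succ, mul_left_comm, inv_mul_cancel_left₀ ha.1.ne']

theorem summable_weight_iff (α : ℝ) {β : ℝ} (hβ : 0 < β) :
    (Summable fun w : State rels => weight α β w) ↔
      Summable fun n : ℕ => (cogrowth rels n : ℝ) * (((n : ℝ) + 1) ^ (1 + α) * β ^ n) := by
  have hsigma : (Summable fun w : State rels => weight α β w) ↔ Summable
      fun z : Σ n, {w : State rels // w.length = n} => weight α β z.2.1 :=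
    ((Equiv.sigmaFiberEquiv (State.length (rels := rels))).summable_iff
      (f := fun w => weight α β w)).symm
  have hnonneg : ∀ z : Σ n, {w : State rels // w.length = n}, 0 ≤ weight α β z.2.1 :=
    fun z => (weight_pos hβ z.2.1).le
  rw [hsigma, summable_sigma_of_nonneg hnonneg]
  have hfin := finite_length_eq (rels := rels)
  have hw : ∀ n, ∑' w : {w : State rels // w.length = n}, weight α β w.1 =
      (cogrowth rels n : ℝ) * (((n : ℝ) + 1) ^ (1 + α) * β ^ n) := fun n => by
    have h1 : ∀ w : {w : State rels // w.length = n},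
        weight α β w.1 = ((n : ℝ) + 1) ^ (1 + α) * β ^ n := fun w => by rw [weight, w.2]
    rw [tsum_congr h1, tsum_const, nsmul_eq_mul, cogrowth]
  constructor
  · exact fun h => h.2.congr fun n => hw n
  · exact fun h => ⟨fun n => Summable.of_finite, h.congr fun n => (hw n).symm⟩

theorem summable_weight_of_lt_cogrowthRadius (α : ℝ) {β : ℝ} (hβ : 0 < β)
    (h : ENNReal.ofReal β < cogrowthRadius rels) :
    Summable fun w : State rels => weight α β w := by
  obtain ⟨a, ha, C, hC, hbound⟩ :=
    FormalMultilinearSeries.norm_mul_pow_le_mul_pow_of_lt_radius _ h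
  simp only [FormalMultilinearSeries.ofScalars_norm, Real.norm_natCast,
    Real.coe_toNNReal _ hβ.le] at hbound
  -- As `n + 1 ≥ 1`, the real power is at most a natural one, which the geometric decay of `c(n) βⁿ`
  -- absorbs.
  obtain ⟨k, hk⟩ := exists_nat_ge (1 + α)
  refine (summable_weight_iff α hβ).2 (Summable.of_nonneg_of_le (fun n => by positivity)
    (fun n => ?_) ((summable_pow_succ_mul_geometric k ha).mul_left C))
  have h1 : ((n : ℝ) + 1) ^ (1 + α) ≤ ((n : ℝ) + 1) ^ k := by
    rw [← Real.rpow_natCast]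
    exact Real.rpow_le_rpow_of_exponent_le (by linarith [Nat.cast_nonneg (α := ℝ) n]) hk
  calc (cogrowth rels n : ℝ) * (((n : ℝ) + 1) ^ (1 + α) * β ^ n)
      = ((n : ℝ) + 1) ^ (1 + α) * (cogrowth rels n * β ^ n) := by ring
    _ ≤ ((n : ℝ) + 1) ^ k * (C * a ^ n) :=
      mul_le_mul h1 (hbound n) (by have := hβ.le; positivity) (by positivity)
    _ = C * (((n : ℝ) + 1) ^ k * a ^ n) := by ring

end Cogrowth

end TrivialWords

/-! ### The stationary law and convergence to it. -/

theorem mainTheorem1 {A : Type*} [Fintype A] [DecidableEq A] [Nonempty A]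
    (rels : Set (FreeGroup A)) (hfin : rels.Finite) (hne : (1 : FreeGroup A) ∉ rels)
    (pc : ℝ) (hpc : pc ∈ Set.Ioo (0 : ℝ) 1) (α β : ℝ) (hβ : β ∈ Set.Ioo (0 : ℝ) 1)
    (P : PMF (TrivialWords.relatorSet rels)) (hPpos : ∀ R, P R ≠ 0)
    (hPsymm : ∀ R, P R = P (TrivialWords.relatorInv R)) :
    (ENNReal.ofReal β < TrivialWords.cogrowthRadius rels →
      Summable fun w : TrivialWords.State rels => TrivialWords.weight α β w) ∧
    ((Summable fun w : TrivialWords.State rels => TrivialWords.weight α β w) →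
      ∃ π : PMF (TrivialWords.State rels),
        (∀ v, (π v).toReal = ((v.length + 1 : ℝ) ^ (1 + α) * β ^ v.length) /
          ∑' w : TrivialWords.State rels, TrivialWords.weight α β w) ∧
        TrivialWords.IsStationary (TrivialWords.step pc hpc α β hβ P) π ∧
        (∀ φ : PMF (TrivialWords.State rels),
          TrivialWords.IsStationary (TrivialWords.step pc hpc α β hβ P) φ → φ = π) ∧
        ∀ u v : TrivialWords.State rels,
          Tendsto (fun n => TrivialWords.nStep (TrivialWords.step pc hpc α β hβ P) n u v)
            atTop (𝓝 (π v))) := by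
  refine ⟨TrivialWords.summable_weight_of_lt_cogrowthRadius α hβ.1, fun hZ => ?_⟩
  set W := fun w : TrivialWords.State rels => TrivialWords.weight α β w with hW
  have hpos : ∀ w, 0 < W w := TrivialWords.weight_pos hβ.1
  let e : TrivialWords.State rels :=
    TrivialWords.State.ofFreeGroup 1 (map_one (PresentedGroup.mk rels))
  have hZpos : 0 < ∑' w, W w := hZ.tsum_pos (fun w => (hpos w).le) e (hpos e)
  let π : PMF (TrivialWords.State rels) := ⟨fun w => ENNReal.ofReal (W w / ∑' w, W w), by
    refine ENNReal.summable.hasSum_iff.2 ?_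
    rw [← ENNReal.ofReal_tsum_of_nonneg (fun w => (div_pos (hpos w) hZpos).le) (hZ.div_const _),
      tsum_div_const, div_self hZpos.ne', ENNReal.ofReal_one]⟩
  have hπ : ∀ w, π w = ENNReal.ofReal (W w / ∑' w, W w) := fun _ => rfl
  have hrev : ∀ v w, π v * TrivialWords.step pc hpc α β hβ P v w =
      π w * TrivialWords.step pc hpc α β hβ P w v := fun v w => by
    rw [hπ, hπ, div_eq_inv_mul, div_eq_inv_mul, ENNReal.ofReal_mul (inv_pos.2 hZpos).le,
      ENNReal.ofReal_mul (inv_pos.2 hZpos).le, mul_assoc, mul_assoc]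
    congr 1
    exact TrivialWords.step_balance α hβ hpc hPsymm v w
  -- Conjugation fixes the empty word `e`, which supplies the loop.
  have hloop : TrivialWords.step pc hpc α β hβ P e e ≠ 0 := by
    obtain ⟨x⟩ : Nonempty (A × Bool) := inferInstance
    have he : TrivialWords.conjMove e x = e := TrivialWords.State.toFreeGroup_injective (by
      rw [TrivialWords.toFreeGroup_conjMove, TrivialWords.State.toFreeGroup_ofFreeGroup, mul_one,
        mul_inv_cancel])
    have h := TrivialWords.step_conjMove_ne_zero α hβ hpc (P := P) e x
    rwa [he] at h
  have hlim := TrivialWords.tendsto_nStep _ π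
    (fun w => (ENNReal.ofReal_pos.2 (div_pos (hpos w) hZpos)).ne') hrev hloop
    (TrivialWords.reflTransGen_step hpc α hβ hPpos e)
  exact ⟨π, fun v => ENNReal.toReal_ofReal (div_pos (hpos v) hZpos).le,
    TrivialWords.isStationary_of_reversible _ π hrev, fun φ hφ => hφ.eq_of_tendsto hlim, hlim⟩
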